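/- Let $N\ge 1$ be an integer and let $\Omega=\mathbb{R}^N\setminus\{0\}$; if $N=1$, one may alternatively take $\Omega=(0,\infty)$. Let $\alpha,b,c\in\mathbb{R}$ and $$L=|x|^\alpha\Delta+c\,|x|^{\alpha-1}\frac{x}{|x|}\cdot\nabla-b\,|x|^{\alpha-2}.$$ Assume that $\alpha\neq 2$ and $b+\left(\frac{N-2+c}{2}\right)^2<0$. Then for every $\lambda>0$ there exists a radial function $\phi\in C_c^\infty(\Omega)$, $\phi\ge 0$, $\phi\not\equiv 0$, such that the equation $$\lambda u-Lu=\phi$$ has no nonnegative distributional solution in $\Omega$; that is, there is no distribution $u$ on $\Omega$ with $\langle u,\psi\rangle\ge 0$ for all $0\le\psi\in C_c^\infty(\Omega)$ that satisfies $\lambda u-Lu=\phi$ in the sense of distributions on $\Omega$. -/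

import Mathlib

open scoped Distributions LineDeriv ContDiff

namespace SingularElliptic

/-- The underlying domain: `ℝ^N ∖ {0}` in every dimension, or, when `N = 1`, alternatively
the half line `(0, ∞)`. -/
def IsSingularDomain {N : ℕ} (Ω : TopologicalSpace.Opens (EuclideanSpace ℝ (Fin N))) : Prop :=
  (Ω : Set (EuclideanSpace ℝ (Fin N))) = {x | x ≠ 0} ∨
    (N = 1 ∧ (Ω : Set (EuclideanSpace ℝ (Fin N))) = {x | ∀ i, 0 < x i})

theorem IsSingularDomain.ne_zero {N : ℕ} (hN : 1 ≤ N)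
    {Ω : TopologicalSpace.Opens (EuclideanSpace ℝ (Fin N))} (hΩ : IsSingularDomain Ω) :
    ∀ x ∈ Ω, x ≠ 0 := by
  intro x hx
  have hx' : x ∈ (Ω : Set (EuclideanSpace ℝ (Fin N))) := hx
  rcases hΩ with h | ⟨_, h⟩
  · rw [h] at hx'
    exact hx'
  · rw [h] at hx'
    rintro rfl
    have := hx' ⟨0, hN⟩
    simp at this

/-- The product `a ψ` of a test function `ψ` on `Ω` with a function `a` that is smooth on `Ω`. -/
noncomputable def smoothMul {N : ℕ} {Ω : TopologicalSpace.Opens (EuclideanSpace ℝ (Fin N))}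
    (a : EuclideanSpace ℝ (Fin N) → ℝ)
    (ha : ∀ x ∈ Ω, ContDiffAt ℝ ∞ a x) (ψ : 𝓓(Ω, ℝ)) : 𝓓(Ω, ℝ) where
  toFun x := a x * ψ x
  contDiff' := by
    refine contDiff_iff_contDiffAt.mpr fun x => ?_
    by_cases hx : x ∈ tsupport ψ
    · exact (ha x (ψ.tsupport_subset hx)).mul ψ.contDiff.contDiffAt
    · have h : (fun y => a y * ψ y) =ᶠ[nhds x] fun _ => 0 := by
        filter_upwards [notMem_tsupport_iff_eventuallyEq.mp hx] with y hy
        simp [hy]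
      exact contDiffAt_const.congr_of_eventuallyEq h
  hasCompactSupport' := ψ.hasCompactSupport.mul_left
  tsupport_subset' := tsupport_mul_subset_right.trans ψ.tsupport_subset

theorem contDiffAt_normPow {N : ℕ} (β : ℝ) {x : EuclideanSpace ℝ (Fin N)} (hx : x ≠ 0) :
    ContDiffAt ℝ ∞ (fun y : EuclideanSpace ℝ (Fin N) => ‖y‖ ^ β) x :=
  (contDiffAt_norm ℝ hx).rpow_const_of_ne (norm_ne_zero_iff.mpr hx)

theorem contDiffAt_drift {N : ℕ} (β : ℝ) (i : Fin N) {x : EuclideanSpace ℝ (Fin N)}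
    (hx : x ≠ 0) :
    ContDiffAt ℝ ∞ (fun y : EuclideanSpace ℝ (Fin N) => ‖y‖ ^ β * (y i / ‖y‖)) x := by
  refine (contDiffAt_normPow β hx).mul
    (ContDiffAt.div ?_ (contDiffAt_norm ℝ hx) (norm_ne_zero_iff.mpr hx))
  fun_prop

/-- The value on the test function `ψ` of the distribution
`L u = |x|^α Δu + c |x|^(α-1) (x/|x|) · ∇u - b |x|^(α-2) u`, where `u` is a distribution on an
open set `Ω` that does not contain the origin. Partial derivatives of `u` are distributional
derivatives, and the product of a distribution `T` with a smooth function `a` is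
`⟨a T, ψ⟩ = ⟨T, a ψ⟩`. -/
noncomputable def applyL {N : ℕ} {Ω : TopologicalSpace.Opens (EuclideanSpace ℝ (Fin N))}
    (h0 : ∀ x ∈ Ω, x ≠ 0) (α b c : ℝ) (u : 𝓓'(Ω, ℝ)) (ψ : 𝓓(Ω, ℝ)) : ℝ :=
  (∑ i : Fin N, (∂_{EuclideanSpace.single i (1 : ℝ)} (∂_{EuclideanSpace.single i (1 : ℝ)} u))
      (smoothMul (fun x => ‖x‖ ^ α) (fun x hx => contDiffAt_normPow α (h0 x hx)) ψ))
    + c * (∑ i : Fin N, (∂_{EuclideanSpace.single i (1 : ℝ)} u)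
      (smoothMul (fun x => ‖x‖ ^ (α - 1) * (x i / ‖x‖))
        (fun x hx => contDiffAt_drift (α - 1) i (h0 x hx)) ψ))
    - b * u (smoothMul (fun x => ‖x‖ ^ (α - 2))
        (fun x hx => contDiffAt_normPow (α - 2) (h0 x hx)) ψ)

/-- `u` solves `lam u - L u = φ` in the sense of distributions on `Ω`. -/
def IsDistributionalSolution {N : ℕ}
    {Ω : TopologicalSpace.Opens (EuclideanSpace ℝ (Fin N))}
    (h0 : ∀ x ∈ Ω, x ≠ 0) (α b c lam : ℝ) (φ : 𝓓(Ω, ℝ)) (u : 𝓓'(Ω, ℝ)) : Prop :=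
  ∀ ψ : 𝓓(Ω, ℝ), lam * u ψ - applyL h0 α b c u ψ = ∫ x, φ x * ψ x

/-- A distribution is nonnegative if it is nonnegative on nonnegative test functions. -/
def IsNonnegDistribution {N : ℕ} {Ω : TopologicalSpace.Opens (EuclideanSpace ℝ (Fin N))}
    (u : 𝓓'(Ω, ℝ)) : Prop :=
  ∀ ψ : 𝓓(Ω, ℝ), (∀ x, 0 ≤ ψ x) → 0 ≤ u ψ

/-- A function is radial on `Ω` if its value depends only on the norm of the point. -/
def IsRadialOn {N : ℕ} (Ω : TopologicalSpace.Opens (EuclideanSpace ℝ (Fin N)))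
    (φ : EuclideanSpace ℝ (Fin N) → ℝ) : Prop :=
  ∀ x ∈ Ω, ∀ y ∈ Ω, ‖x‖ = ‖y‖ → φ x = φ y

end SingularElliptic

/-! By duality it suffices to find a nontrivial radial test function `ψ ≥ 0` with `lam ψ ≤ L* ψ`
(`exists_radial_subsolution`). Take `φ = ψ`: a solution `u ≥ 0` tested against `ψ` gives `∫ ψ² =
-u(L* ψ - lam ψ) ≤ 0`, which is absurd.

Put `ψ = |x|^(γ-α) h(s)` with `s = log |x|`. For `γ = (c-N+2)/2` the first-order term disappears and
`L* ψ = |x|^(γ-2) (h'' + 2m h)`, where `2m = -(b + ((N-2+c)/2)²) > 0` (`adjointL_apply_radial`),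
while `lam ψ = |x|^(γ-2) lam e^((2-α)s) h`. A wide bump satisfies `h'' + m h ≥ 0`
(`exists_bump_subsolution`). As `α ≠ 2`, translating it far along the `s`-line makes `lam e^((2-α)s)
≤ m` on its support (`exists_forall_mul_exp_le`). -/

namespace SingularElliptic

/-! ### A compactly supported subsolution on the line. -/

section OneDimensional

theorem hasDerivAt_expNegInvGlue (x : ℝ) :
    HasDerivAt expNegInvGlue (x⁻¹ ^ 2 * expNegInvGlue x) x := by
  simpa using expNegInvGlue.hasDerivAt_polynomial_eval_inv_mul 1 x

theorem hasDerivAt_inv_sq_mul_expNegInvGlue (x : ℝ) :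
    HasDerivAt (fun y : ℝ => y⁻¹ ^ 2 * expNegInvGlue y)
      ((x⁻¹ ^ 4 - 2 * x⁻¹ ^ 3) * expNegInvGlue x) x := by
  have h := expNegInvGlue.hasDerivAt_polynomial_eval_inv_mul (Polynomial.X ^ 2) x
  simp only [Polynomial.eval_pow, Polynomial.eval_X] at h
  refine h.congr_deriv ?_
  congr 1
  simp
  ring

/-- The logarithmic second derivative of `expNegInvGlue (1 + t) * expNegInvGlue (1 - t)` is bounded
below by `-9` on `(-1, 1)`; here `A = (1 + t)⁻¹` and `B = (1 - t)⁻¹`. -/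
theorem neg_nine_le_logSecondDeriv {A B : ℝ} (hA : 0 < A) (hB : 0 < B) (h : A + B = 2 * (A * B)) :
    0 ≤ (A ^ 4 - 2 * A ^ 3) - 2 * (A ^ 2 * B ^ 2) + (B ^ 4 - 2 * B ^ 3) + 9 := by
  obtain ⟨P, hP⟩ : ∃ P, P = A * B := ⟨_, rfl⟩
  have hP0 : 0 < P := hP ▸ mul_pos hA hB
  -- The expression is symmetric in `A` and `B`, and `A + B = 2P`, so it is a polynomial in `P`
  -- alone.
  have e : (A ^ 4 - 2 * A ^ 3) - 2 * (A ^ 2 * B ^ 2) + (B ^ 4 - 2 * B ^ 3)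
      = 4 * P ^ 2 * ((2 * P - 1) * (2 * P - 3)) := by
    have hS : A + B = 2 * P := by rw [h, hP]
    have e1 : (A ^ 4 - 2 * A ^ 3) - 2 * (A ^ 2 * B ^ 2) + (B ^ 4 - 2 * B ^ 3)
        = (A + B) ^ 2 * ((A + B) ^ 2 - 4 * (A * B))
          - 2 * ((A + B) ^ 3 - 3 * (A * B) * (A + B)) := by ring
    rw [e1, hS, ← hP]
    ring
  rw [e]
  rcases le_total (3 / 2) P with h1 | h1
  · have : 0 ≤ (2 * P - 1) * (2 * P - 3) := mul_nonneg (by linarith) (by linarith)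
    positivity
  · have h2 : 4 * P ^ 2 * ((2 * P - 1) * (2 * P - 3)) + 9
        = (4 * P * (P - 1)) ^ 2 + (3 - 2 * P) * (3 + 2 * P) := by ring
    rw [h2]
    have : 0 ≤ (3 - 2 * P) * (3 + 2 * P) := mul_nonneg (by linarith) (by linarith)
    positivity

/-- For every `m > 0` there is a nontrivial nonnegative smooth compactly supported subsolution
of `h'' + m h = 0` on the real line. -/
theorem exists_bump_subsolution {m : ℝ} (hm : 0 < m) :
    ∃ (R : ℝ) (h h₁ h₂ : ℝ → ℝ), 0 < R ∧ ContDiff ℝ ∞ h ∧ (∀ s, HasDerivAt h (h₁ s) s) ∧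
      (∀ s, HasDerivAt h₁ (h₂ s) s) ∧ (∀ s, 0 ≤ h s) ∧ 0 < h 0 ∧ (∀ s, R ≤ |s| → h s = 0) ∧
      (∀ s, R ≤ |s| → h₂ s = 0) ∧ ∀ s, 0 ≤ h₂ s + m * h s := by
  -- Replacing `t` by `ε s` multiplies the bound `-9` by `ε²`, so `9 ε² = m` turns it into `-m`.
  obtain ⟨ε, hε, hεm⟩ : ∃ ε : ℝ, 0 < ε ∧ 9 * ε ^ 2 = m :=
    ⟨√m / 3, by positivity, by rw [div_pow, Real.sq_sqrt hm.le]; ring⟩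
  let g := expNegInvGlue
  let g₁ : ℝ → ℝ := fun y => y⁻¹ ^ 2 * expNegInvGlue y
  let g₂ : ℝ → ℝ := fun y => (y⁻¹ ^ 4 - 2 * y⁻¹ ^ 3) * expNegInvGlue y
  have hp (s : ℝ) : HasDerivAt (fun s : ℝ => 1 + ε * s) ε s := by
    simpa using ((hasDerivAt_id s).const_mul ε).const_add 1
  have hn (s : ℝ) : HasDerivAt (fun s : ℝ => 1 - ε * s) (-ε) s := by
    simpa using ((hasDerivAt_id s).const_mul ε).const_sub 1
  have hgp (s : ℝ) : HasDerivAt (fun s => g (1 + ε * s)) (g₁ (1 + ε * s) * ε) s :=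
    (hasDerivAt_expNegInvGlue _).comp s (hp s)
  have hgn (s : ℝ) : HasDerivAt (fun s => g (1 - ε * s)) (g₁ (1 - ε * s) * -ε) s :=
    (hasDerivAt_expNegInvGlue _).comp s (hn s)
  have hgp' (s : ℝ) : HasDerivAt (fun s => g₁ (1 + ε * s)) (g₂ (1 + ε * s) * ε) s :=
    (hasDerivAt_inv_sq_mul_expNegInvGlue _).comp s (hp s)
  have hgn' (s : ℝ) : HasDerivAt (fun s => g₁ (1 - ε * s)) (g₂ (1 - ε * s) * -ε) s :=
    (hasDerivAt_inv_sq_mul_expNegInvGlue _).comp s (hn s)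
  have hout (s : ℝ) (hs : ε⁻¹ ≤ |s|) : g (1 + ε * s) = 0 ∨ g (1 - ε * s) = 0 := by
    have h1 : 1 ≤ ε * |s| := by
      calc (1 : ℝ) = ε * ε⁻¹ := (mul_inv_cancel₀ hε.ne').symm
        _ ≤ ε * |s| := by gcongr
    rcases abs_cases s with ⟨h2, _⟩ | ⟨h2, _⟩ <;> rw [h2] at h1
    · right
      exact expNegInvGlue.zero_of_nonpos (by linarith)
    · left
      exact expNegInvGlue.zero_of_nonpos (by linarith)
  -- The bump factors out of its second derivative, which gives both the vanishing outside and the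
  -- sign inside. Only ring identities are used, so the points where `1 ± ε s = 0` are included.
  have hfac (s : ℝ) : g₂ (1 + ε * s) * ε * ε * g (1 - ε * s)
        - 2 * (g₁ (1 + ε * s) * ε * (g₁ (1 - ε * s) * ε))
        + g (1 + ε * s) * (g₂ (1 - ε * s) * ε * ε)
      = ε ^ 2 * (g (1 + ε * s) * g (1 - ε * s)) *
        (((1 + ε * s)⁻¹ ^ 4 - 2 * (1 + ε * s)⁻¹ ^ 3)
          - 2 * ((1 + ε * s)⁻¹ ^ 2 * (1 - ε * s)⁻¹ ^ 2)
          + ((1 - ε * s)⁻¹ ^ 4 - 2 * (1 - ε * s)⁻¹ ^ 3)) := by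
    simp only [g, g₁, g₂]
    ring
  refine ⟨ε⁻¹, fun s => g (1 + ε * s) * g (1 - ε * s),
    fun s => g₁ (1 + ε * s) * ε * g (1 - ε * s) + g (1 + ε * s) * (g₁ (1 - ε * s) * -ε),
    fun s => g₂ (1 + ε * s) * ε * ε * g (1 - ε * s)
      - 2 * (g₁ (1 + ε * s) * ε * (g₁ (1 - ε * s) * ε))
      + g (1 + ε * s) * (g₂ (1 - ε * s) * ε * ε),
    inv_pos.mpr hε, ?_, fun s => (hgp s).mul (hgn s), fun s => ?_, fun s => ?_, ?_, fun s hs => ?_,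
    fun s hs => ?_, fun s => ?_⟩
  · exact (expNegInvGlue.contDiff.comp (by fun_prop)).mul
      (expNegInvGlue.contDiff.comp (by fun_prop))
  · refine ((((hgp' s).mul_const ε).mul (hgn s)).add
      ((hgp s).mul ((hgn' s).mul_const (-ε)))).congr_deriv ?_
    ring
  · exact mul_nonneg (expNegInvGlue.nonneg _) (expNegInvGlue.nonneg _)
  · simp [g, expNegInvGlue.pos_of_pos]
  · rcases hout s hs with h | h <;> simp [h]
  · beta_reduce
    rw [hfac]
    rcases hout s hs with h | h <;> simp [h]
  · beta_reduce
    rw [hfac, ← hεm]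
    rcases le_or_gt ε⁻¹ |s| with hs | hs
    · rcases hout s hs with h | h <;> simp [h]
    · have h1 : |ε * s| < 1 := by
        rw [abs_mul, abs_of_pos hε]
        calc ε * |s| < ε * ε⁻¹ := by gcongr
          _ = 1 := mul_inv_cancel₀ hε.ne'
      obtain ⟨h2, h3⟩ := abs_lt.mp h1
      have hA : 0 < 1 + ε * s := by linarith
      have hB : 0 < 1 - ε * s := by linarith
      have key := neg_nine_le_logSecondDeriv (inv_pos.mpr hA) (inv_pos.mpr hB)
        (by field_simp; ring)
      have hg : 0 ≤ ε ^ 2 * (g (1 + ε * s) * g (1 - ε * s)) :=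
        mul_nonneg (sq_nonneg _)
          (mul_nonneg (expNegInvGlue.nonneg _) (expNegInvGlue.nonneg _))
      have := mul_nonneg hg key
      linarith

end OneDimensional

/-! ### Derivatives of radial functions in the variable `log |x|`. -/

section Radial

variable {N : ℕ}

theorem hasLineDerivAt_norm (i : Fin N) {x : EuclideanSpace ℝ (Fin N)} (hx : x ≠ 0) :
    HasLineDerivAt ℝ (fun y : EuclideanSpace ℝ (Fin N) => ‖y‖) (x i / ‖x‖) x
      (EuclideanSpace.single i (1 : ℝ)) := by
  have hl : HasDerivAt (fun t : ℝ => x + t • EuclideanSpace.single i (1 : ℝ))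
      (EuclideanSpace.single i (1 : ℝ)) 0 := by
    simpa using ((hasDerivAt_id (0 : ℝ)).smul_const (EuclideanSpace.single i (1 : ℝ))).const_add x
  have h := hl.norm_sq.sqrt (by simpa using hx)
  have hn := norm_ne_zero_iff.mpr hx
  simp only [Real.sqrt_sq (norm_nonneg _)] at h
  unfold HasLineDerivAt
  refine h.congr_deriv ?_
  simp [EuclideanSpace.inner_single_right]
  field_simp

/-- The gradient is again a radial profile times `x`, the form whose divergence is taken in
`sum_partial_radial`. -/
theorem hasLineDerivAt_normPow_mul_comp_log (i : Fin N) {x : EuclideanSpace ℝ (Fin N)}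
    (hx : x ≠ 0) (γ : ℝ) {η : ℝ → ℝ} {η' : ℝ} (hη : HasDerivAt η η' (Real.log ‖x‖)) :
    HasLineDerivAt ℝ (fun y : EuclideanSpace ℝ (Fin N) => ‖y‖ ^ γ * η (Real.log ‖y‖))
      (‖x‖ ^ (γ - 2) * x i * (γ * η (Real.log ‖x‖) + η')) x
      (EuclideanSpace.single i (1 : ℝ)) := by
  have hn : 0 < ‖x‖ := norm_pos_iff.mpr hx
  have h1 : HasDerivAt (fun r : ℝ => r ^ γ * η (Real.log r))
      (γ * ‖x‖ ^ (γ - 1) * η (Real.log ‖x‖) + ‖x‖ ^ γ * (η' * ‖x‖⁻¹)) ‖x‖ :=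
    (Real.hasDerivAt_rpow_const (Or.inl hn.ne')).mul
      (hη.comp ‖x‖ (Real.hasDerivAt_log hn.ne'))
  have h2 := hasLineDerivAt_norm i hx
  unfold HasLineDerivAt at h2 ⊢
  have h1' : HasDerivAt (fun r : ℝ => r ^ γ * η (Real.log r))
      (γ * ‖x‖ ^ (γ - 1) * η (Real.log ‖x‖) + ‖x‖ ^ γ * (η' * ‖x‖⁻¹))
      ‖x + (0 : ℝ) • EuclideanSpace.single i (1 : ℝ)‖ := by simpa using h1
  refine (h1'.comp (0 : ℝ) h2).congr_deriv ?_
  have e1 : ‖x‖ ^ (γ - 1) = ‖x‖ ^ (γ - 2) * ‖x‖ := by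
    rw [← Real.rpow_add_one hn.ne']; ring_nf
  have e2 : ‖x‖ ^ γ = ‖x‖ ^ (γ - 2) * ‖x‖ ^ 2 := by
    rw [← Real.rpow_add_natCast hn.ne']; norm_num
  rw [e1, e2]
  field_simp

theorem hasLineDerivAt_normPow_mul_coord_mul_comp_log (i : Fin N)
    {x : EuclideanSpace ℝ (Fin N)} (hx : x ≠ 0) (γ : ℝ) {η : ℝ → ℝ} {η' : ℝ}
    (hη : HasDerivAt η η' (Real.log ‖x‖)) :
    HasLineDerivAt ℝ (fun y : EuclideanSpace ℝ (Fin N) => ‖y‖ ^ γ * y i * η (Real.log ‖y‖))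
      (‖x‖ ^ γ * η (Real.log ‖x‖)
        + ‖x‖ ^ (γ - 2) * x i ^ 2 * (γ * η (Real.log ‖x‖) + η')) x
      (EuclideanSpace.single i (1 : ℝ)) := by
  have h1 := hasLineDerivAt_normPow_mul_comp_log i hx γ hη
  have h2 : HasLineDerivAt ℝ (fun y : EuclideanSpace ℝ (Fin N) => y i) 1 x
      (EuclideanSpace.single i (1 : ℝ)) := by
    unfold HasLineDerivAt
    simpa using (hasDerivAt_id (0 : ℝ)).const_add (x i)
  unfold HasLineDerivAt at h1 h2 ⊢
  have h3 := h1.mul h2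
  refine (h3.congr_of_eventuallyEq (.of_forall fun t => ?_)).congr_deriv ?_
  · simp only [Pi.mul_apply]
    ring
  · simp
    ring

/-- The divergence of the radial field `|x|^γ η(log |x|) x`. -/
theorem sum_partial_radial {x : EuclideanSpace ℝ (Fin N)} (hx : x ≠ 0) (γ p q : ℝ) :
    ∑ i : Fin N, (‖x‖ ^ γ * p + ‖x‖ ^ (γ - 2) * x i ^ 2 * (γ * p + q))
      = ‖x‖ ^ γ * ((N + γ) * p + q) := by
  have hn : 0 < ‖x‖ := norm_pos_iff.mpr hx
  have e2 : ‖x‖ ^ γ = ‖x‖ ^ (γ - 2) * ‖x‖ ^ 2 := by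
    rw [← Real.rpow_add_natCast hn.ne']; norm_num
  rw [Finset.sum_add_distrib, ← Finset.sum_mul (f := fun i => ‖x‖ ^ (γ - 2) * x i ^ 2),
    ← Finset.mul_sum (f := fun i => x i ^ 2), ← EuclideanSpace.real_norm_sq_eq, ← e2]
  simp
  ring

end Radial

/-! ### Radial test functions and the formal adjoint of `L`. -/

section TestFunctions

variable {N : ℕ} {Ω : TopologicalSpace.Opens (EuclideanSpace ℝ (Fin N))}

/-- The origin is the only possible boundary point, also for the half line; hence a closed annulus
intersected with `closure Ω` is a compact subset of `Ω`. -/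
theorem IsSingularDomain.mem_of_mem_closure (hΩ : IsSingularDomain Ω)
    {x : EuclideanSpace ℝ (Fin N)} (hx : x ∈ closure (Ω : Set (EuclideanSpace ℝ (Fin N))))
    (hx0 : x ≠ 0) : x ∈ Ω := by
  rw [← SetLike.mem_coe]
  rcases hΩ with h | ⟨rfl, h⟩
  · rw [h]
    exact hx0
  · have hcl : IsClosed {x : EuclideanSpace ℝ (Fin 1) | ∀ i, 0 ≤ x i} := by
      simp only [Set.ofPred_forall]
      exact isClosed_iInter fun i => isClosed_le continuous_const (by fun_prop)
    rw [h] at hx ⊢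
    have hx1 := closure_minimal (fun y hy i => (hy i).le) hcl hx
    intro i
    refine lt_of_le_of_ne (hx1 i) fun h0 => hx0 ?_
    ext j
    rw [Subsingleton.elim j i, ← h0]
    rfl

/-- There is a point of any prescribed positive norm in the domain. -/
theorem IsSingularDomain.exists_norm_eq (hN : 1 ≤ N) (hΩ : IsSingularDomain Ω) {r : ℝ}
    (hr : 0 < r) : ∃ x ∈ Ω, ‖x‖ = r := by
  refine ⟨EuclideanSpace.single ⟨0, hN⟩ r, ?_, by simp [abs_of_pos hr]⟩
  rw [← SetLike.mem_coe]
  rcases hΩ with h | ⟨rfl, h⟩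
  · rw [h]
    simpa using hr.ne'
  · rw [h]
    intro i
    rw [Subsingleton.elim i ⟨0, hN⟩]
    simpa using hr

/-- A function that is smooth away from the origin and vanishes outside an annulus, cut off to
the domain, is a test function. -/
theorem IsSingularDomain.exists_testFunction (hN : 1 ≤ N) (hΩ : IsSingularDomain Ω)
    {f : EuclideanSpace ℝ (Fin N) → ℝ} (hf : ∀ x, x ≠ 0 → ContDiffAt ℝ ∞ f x) {r₁ r₂ : ℝ}
    (hr : 0 < r₁) (hf0 : ∀ x ∈ Ω, ‖x‖ < r₁ ∨ r₂ < ‖x‖ → f x = 0) :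
    ∃ ψ : 𝓓(Ω, ℝ), (∀ x ∈ Ω, ψ x = f x) ∧ ∀ x ∉ Ω, ψ x = 0 := by
  -- The cut-off matters for the half line, where `f` need not vanish on the negative side.
  let F : EuclideanSpace ℝ (Fin N) → ℝ := (Ω : Set (EuclideanSpace ℝ (Fin N))).indicator f
  let K := closure (Ω : Set (EuclideanSpace ℝ (Fin N))) ∩ {x | r₁ ≤ ‖x‖ ∧ ‖x‖ ≤ r₂}
  have hKc : IsClosed {x : EuclideanSpace ℝ (Fin N) | r₁ ≤ ‖x‖ ∧ ‖x‖ ≤ r₂} :=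
    (isClosed_le continuous_const continuous_norm).inter
      (isClosed_le continuous_norm continuous_const)
  have hK : IsCompact K := by
    refine Metric.isCompact_of_isClosed_isBounded (isClosed_closure.inter hKc) ?_
    refine (Metric.isBounded_closedBall (x := 0) (r := r₂)).subset fun x hx => ?_
    simpa using hx.2.2
  have hKΩ : K ⊆ Ω := fun x hx =>
    hΩ.mem_of_mem_closure hx.1 (norm_pos_iff.mp (hr.trans_le hx.2.1))
  have hsupp : tsupport F ⊆ K := by
    refine closure_minimal (fun x hx => ?_) hK.isClosed
    have hxΩ : x ∈ (Ω : Set (EuclideanSpace ℝ (Fin N))) := Set.mem_of_indicator_ne_zero hx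
    refine ⟨subset_closure hxΩ, ?_⟩
    by_contra hcon
    refine hx ?_
    simp only [F, Set.indicator_of_mem hxΩ]
    refine hf0 x hxΩ ?_
    simp only [Set.mem_ofPred_eq, not_and_or, not_le] at hcon
    exact hcon
  have hsm : ContDiff ℝ ∞ F := by
    refine contDiff_iff_contDiffAt.mpr fun x => ?_
    by_cases hx : x ∈ Ω
    · refine (hf x (hΩ.ne_zero hN x hx)).congr_of_eventuallyEq ?_
      filter_upwards [Ω.isOpen.mem_nhds hx] with y hy
      exact Set.indicator_of_mem hy f
    · exact contDiffAt_const.congr_of_eventuallyEq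
        (notMem_tsupport_iff_eventuallyEq.mp fun h => hx (hKΩ (hsupp h)))
  exact ⟨⟨F, hsm, hK.of_isClosed_subset (isClosed_tsupport _) hsupp, hsupp.trans hKΩ⟩,
    fun x hx => Set.indicator_of_mem hx f, fun x hx => Set.indicator_of_notMem hx f⟩

theorem testFunction_eq_zero_of_notMem (ψ : 𝓓(Ω, ℝ)) {x : EuclideanSpace ℝ (Fin N)}
    (hx : x ∉ Ω) : ψ x = 0 :=
  image_eq_zero_of_notMem_tsupport fun h => hx (ψ.tsupport_subset h)

/-- The derivative of a test function is computed from any formula valid on the open set `Ω`. -/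
theorem lineDerivOp_apply_of_eqOn {ψ : 𝓓(Ω, ℝ)} {f : EuclideanSpace ℝ (Fin N) → ℝ}
    (hψ : ∀ y ∈ Ω, ψ y = f y) {x v : EuclideanSpace ℝ (Fin N)} (hx : x ∈ Ω) {f' : ℝ}
    (hf : HasLineDerivAt ℝ f f' x v) : (∂_{v} ψ) x = f' := by
  have h1 : (∂_{v} ψ) x = lineDeriv ℝ ψ x v :=
    TestFunction.lineDerivCLM_apply_of_le (𝕜 := ℝ) (by simp)
  rw [h1]
  refine HasLineDerivAt.lineDeriv (hf.congr_of_eventuallyEq ?_)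
  filter_upwards [Ω.isOpen.mem_nhds hx] with y hy
  exact hψ y hy

/-- The formal adjoint `ψ ↦ Δ(|x|^α ψ) - c div(|x|^(α-1) (x/|x|) ψ) - b |x|^(α-2) ψ`. -/
noncomputable def adjointL (h0 : ∀ x ∈ Ω, x ≠ 0) (α b c : ℝ) (ψ : 𝓓(Ω, ℝ)) : 𝓓(Ω, ℝ) :=
  (∑ i : Fin N, ∂_{EuclideanSpace.single i (1 : ℝ)} (∂_{EuclideanSpace.single i (1 : ℝ)}
      (smoothMul (fun x => ‖x‖ ^ α) (fun x hx => contDiffAt_normPow α (h0 x hx)) ψ)))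
    - c • (∑ i : Fin N, ∂_{EuclideanSpace.single i (1 : ℝ)}
      (smoothMul (fun x => ‖x‖ ^ (α - 1) * (x i / ‖x‖))
        (fun x hx => contDiffAt_drift (α - 1) i (h0 x hx)) ψ))
    - b • smoothMul (fun x => ‖x‖ ^ (α - 2))
        (fun x hx => contDiffAt_normPow (α - 2) (h0 x hx)) ψ

/-- Each derivative moved onto the test function costs a sign: the two in `Δ` cancel, the one in the
drift term gives `-c`. -/
theorem applyL_eq_adjointL (h0 : ∀ x ∈ Ω, x ≠ 0) (α b c : ℝ) (u : 𝓓'(Ω, ℝ)) (ψ : 𝓓(Ω, ℝ)) :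
    applyL h0 α b c u ψ = u (adjointL h0 α b c ψ) := by
  have hd (v : EuclideanSpace ℝ (Fin N)) (T : 𝓓'(Ω, ℝ)) (χ : 𝓓(Ω, ℝ)) :
      (∂_{v} T) χ = - T (∂_{v} χ) := rfl
  simp only [applyL, adjointL, hd, neg_neg, map_sub, map_smul, map_sum, smul_eq_mul,
    Finset.sum_neg_distrib]
  ring

/-- The formal adjoint of `L` on `|x|^(γ-α) h(log |x|)`. -/
theorem adjointL_apply_radial (h0 : ∀ x ∈ Ω, x ≠ 0) (α b c γ : ℝ) {h h₁ h₂ : ℝ → ℝ}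
    (hh : ∀ s, HasDerivAt h (h₁ s) s) (hh₁ : ∀ s, HasDerivAt h₁ (h₂ s) s) {ψ : 𝓓(Ω, ℝ)}
    (hψ : ∀ x ∈ Ω, ψ x = ‖x‖ ^ (γ - α) * h (Real.log ‖x‖))
    {x : EuclideanSpace ℝ (Fin N)} (hx : x ∈ Ω) :
    adjointL h0 α b c ψ x = ‖x‖ ^ (γ - 2) * (h₂ (Real.log ‖x‖)
      + (N - 2 + 2 * γ - c) * h₁ (Real.log ‖x‖)
      + ((γ - c) * (N + γ - 2) - b) * h (Real.log ‖x‖)) := by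
  have hpos {y} (hy : y ∈ Ω) : 0 < ‖y‖ := norm_pos_iff.mpr (h0 y hy)
  have hA (y) (hy : y ∈ Ω) : smoothMul (fun x => ‖x‖ ^ α)
      (fun x hx => contDiffAt_normPow α (h0 x hx)) ψ y = ‖y‖ ^ γ * h (Real.log ‖y‖) := by
    change ‖y‖ ^ α * ψ y = _
    rw [hψ y hy, ← mul_assoc, ← Real.rpow_add (hpos hy)]
    ring_nf
  have hB (i : Fin N) (y) (hy : y ∈ Ω) : smoothMul (fun x => ‖x‖ ^ (α - 1) * (x i / ‖x‖))
      (fun x hx => contDiffAt_drift (α - 1) i (h0 x hx)) ψ y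
        = ‖y‖ ^ (γ - 2) * y i * h (Real.log ‖y‖) := by
    change ‖y‖ ^ (α - 1) * (y i / ‖y‖) * ψ y = _
    have e : ‖y‖ ^ (γ - 2) = ‖y‖ ^ (α - 1) * ‖y‖ ^ (γ - α) * ‖y‖⁻¹ := by
      rw [← Real.rpow_neg_one, ← Real.rpow_add (hpos hy), ← Real.rpow_add (hpos hy)]
      ring_nf
    rw [hψ y hy, e]
    ring
  have hC : smoothMul (fun x => ‖x‖ ^ (α - 2))
      (fun x hx => contDiffAt_normPow (α - 2) (h0 x hx)) ψ x
        = ‖x‖ ^ (γ - 2) * h (Real.log ‖x‖) := by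
    change ‖x‖ ^ (α - 2) * ψ x = _
    rw [hψ x hx, ← mul_assoc, ← Real.rpow_add (hpos hx)]
    ring_nf
  have hη (s : ℝ) : HasDerivAt (fun s => γ * h s + h₁ s) (γ * h₁ s + h₂ s) s :=
    ((hh s).const_mul γ).add (hh₁ s)
  have hdA (i : Fin N) (y) (hy : y ∈ Ω) := lineDerivOp_apply_of_eqOn hA hy
    (hasLineDerivAt_normPow_mul_comp_log i (h0 y hy) γ (hh _))
  have hddA (i : Fin N) := lineDerivOp_apply_of_eqOn (hdA i) hx
    (hasLineDerivAt_normPow_mul_coord_mul_comp_log i (h0 x hx) (γ - 2) (hη _))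
  have hdB (i : Fin N) := lineDerivOp_apply_of_eqOn (hB i) hx
    (hasLineDerivAt_normPow_mul_coord_mul_comp_log i (h0 x hx) (γ - 2) (hh _))
  have hs (F : Fin N → 𝓓(Ω, ℝ)) : (∑ i, F i) x = ∑ i, F i x := by simp
  simp only [adjointL, sub_apply, smul_apply, hs, smul_eq_mul, hddA, hdB, hC]
  rw [sum_partial_radial (h0 x hx), sum_partial_radial (h0 x hx)]
  ring

end TestFunctions

/-! ### The subsolution of the adjoint problem and the contradiction. -/

/-- Far enough along the line in one direction, `lam * exp (κ * s)` is small. -/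
theorem exists_forall_mul_exp_le {κ lam m R : ℝ} (hκ : κ ≠ 0) (hlam : 0 < lam) (hm : 0 < m) :
    ∃ s₀ : ℝ, ∀ s, |s - s₀| ≤ R → lam * Real.exp (κ * s) ≤ m := by
  -- On `|s - s₀| ≤ R` the exponent `κ s` is at most `κ s₀ + |κ| R`; `s₀` makes this equal to `log
  -- (m / lam)`.
  refine ⟨(Real.log (m / lam) - |κ| * R) / κ, fun s hs => ?_⟩
  set s₀ := (Real.log (m / lam) - |κ| * R) / κ with hs₀
  have h1 : κ * s₀ = Real.log (m / lam) - |κ| * R := by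
    rw [hs₀]
    field_simp
  have h2 : κ * (s - s₀) ≤ |κ| * R :=
    (le_abs_self _).trans (by rw [abs_mul]; gcongr)
  have h3 : κ * s ≤ Real.log (m / lam) := by linarith
  calc lam * Real.exp (κ * s) ≤ lam * Real.exp (Real.log (m / lam)) := by gcongr
    _ = m := by
      rw [Real.exp_log (by positivity)]
      field_simp

/-- There is a nontrivial nonnegative radial test function `ψ` with `lam ψ ≤ L* ψ`. -/
theorem exists_radial_subsolution {N : ℕ} (hN : 1 ≤ N)
    {Ω : TopologicalSpace.Opens (EuclideanSpace ℝ (Fin N))} (hΩ : IsSingularDomain Ω)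
    {α b c : ℝ} (hα : α ≠ 2) (hD : b + (((N : ℝ) - 2 + c) / 2) ^ 2 < 0) {lam : ℝ}
    (hlam : 0 < lam) :
    ∃ ψ : 𝓓(Ω, ℝ), (∀ x, 0 ≤ ψ x) ∧ ψ ≠ 0 ∧ IsRadialOn Ω ψ ∧
      ∀ x, lam * ψ x ≤ adjointL (hΩ.ne_zero hN) α b c ψ x := by
  -- The positive zero-order coefficient is split in halves: one absorbs `h''`, the other dominates
  -- `lam e^((2-α)s)`.
  obtain ⟨m, hm, hmD⟩ : ∃ m, 0 < m ∧ -(b + (((N : ℝ) - 2 + c) / 2) ^ 2) = m + m :=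
    ⟨-(b + (((N : ℝ) - 2 + c) / 2) ^ 2) / 2, by linarith, by ring⟩
  obtain ⟨R, g, g₁, g₂, hR, hgs, hg, hg₁, hg0, hgpos, hgz, hg₂z, hgm⟩ :=
    exists_bump_subsolution hm
  obtain ⟨s₀, hs₀⟩ := exists_forall_mul_exp_le (R := R) (sub_ne_zero.mpr hα.symm) hlam hm
  -- This is the root of `N - 2 + 2γ - c = 0`, the coefficient of `h'`.
  obtain ⟨γ, hγ⟩ : ∃ γ : ℝ, γ = (c - N + 2) / 2 := ⟨_, rfl⟩
  have hh (s : ℝ) : HasDerivAt (fun s => g (s - s₀)) (g₁ (s - s₀)) s :=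
    (hg (s - s₀)).comp_sub_const s s₀
  have hh₁ (s : ℝ) : HasDerivAt (fun s => g₁ (s - s₀)) (g₂ (s - s₀)) s :=
    (hg₁ (s - s₀)).comp_sub_const s s₀
  have hf (x : EuclideanSpace ℝ (Fin N)) (hx : x ≠ 0) :
      ContDiffAt ℝ ∞ (fun x => ‖x‖ ^ (γ - α) * g (Real.log ‖x‖ - s₀)) x :=
    (contDiffAt_normPow _ hx).mul (hgs.contDiffAt.comp x
      (((contDiffAt_norm ℝ hx).log (norm_ne_zero_iff.mpr hx)).sub contDiffAt_const))
  obtain ⟨ψ, hψ, hψ0⟩ := hΩ.exists_testFunction hN hf (r₁ := Real.exp (s₀ - R))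
    (r₂ := Real.exp (s₀ + R)) (Real.exp_pos _) (by
      intro x hx hr
      have hx0 : 0 < ‖x‖ := norm_pos_iff.mpr (hΩ.ne_zero hN x hx)
      rw [← Real.log_lt_iff_lt_exp hx0, ← Real.lt_log_iff_exp_lt hx0] at hr
      rw [hgz, mul_zero]
      rcases hr with hr | hr
      · exact le_trans (by linarith) (neg_le_abs _)
      · exact le_trans (by linarith) (le_abs_self _))
  refine ⟨ψ, fun x => ?_, fun h => ?_, fun x hx y hy hxy => ?_, fun x => ?_⟩
  · by_cases hx : x ∈ Ω
    · rw [hψ x hx]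
      exact mul_nonneg (Real.rpow_nonneg (norm_nonneg _) _) (hg0 _)
    · exact (hψ0 x hx).ge
  · obtain ⟨x, hx, hxn⟩ := hΩ.exists_norm_eq hN (Real.exp_pos s₀)
    have h1 : 0 < ψ x := by
      rw [hψ x hx, hxn, Real.log_exp, sub_self]
      positivity
    rw [h] at h1
    exact lt_irrefl _ h1
  · rw [hψ x hx, hψ y hy, hxy]
  · by_cases hx : x ∈ Ω
    · rw [adjointL_apply_radial (hΩ.ne_zero hN) α b c γ hh hh₁ hψ hx, hψ x hx]
      have hx0 : 0 < ‖x‖ := norm_pos_iff.mpr (hΩ.ne_zero hN x hx)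
      have e1 : (N : ℝ) - 2 + 2 * γ - c = 0 := by rw [hγ]; ring
      have e2 : (γ - c) * (N + γ - 2) - b = m + m := by rw [← hmD, hγ]; ring
      -- The weights of `ψ` and `L* ψ` differ by `|x|^(2-α)`, an exponential in `s`.
      have e3 : ‖x‖ ^ (γ - α) = ‖x‖ ^ (γ - 2) * Real.exp ((2 - α) * Real.log ‖x‖) := by
        rw [mul_comm (2 - α), ← Real.rpow_def_of_pos hx0, ← Real.rpow_add hx0]
        ring_nf
      rw [e1, e2, e3]
      set s := Real.log ‖x‖
      have key : lam * Real.exp ((2 - α) * s) * g (s - s₀)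
          ≤ g₂ (s - s₀) + (m + m) * g (s - s₀) := by
        rcases le_or_gt |s - s₀| R with hs | hs
        · have h1 := mul_le_mul_of_nonneg_right (hs₀ s hs) (hg0 (s - s₀))
          linarith [hgm (s - s₀)]
        · rw [hgz _ hs.le, hg₂z _ hs.le]
          simp
      calc lam * (‖x‖ ^ (γ - 2) * Real.exp ((2 - α) * s) * g (s - s₀))
          = ‖x‖ ^ (γ - 2) * (lam * Real.exp ((2 - α) * s) * g (s - s₀)) := by ring
        _ ≤ ‖x‖ ^ (γ - 2) * (g₂ (s - s₀) + (m + m) * g (s - s₀)) := by gcongr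
        _ = _ := by ring
    · rw [testFunction_eq_zero_of_notMem _ hx, testFunction_eq_zero_of_notMem _ hx, mul_zero]

theorem integral_mul_self_pos {N : ℕ} {Ω : TopologicalSpace.Opens (EuclideanSpace ℝ (Fin N))}
    {ψ : 𝓓(Ω, ℝ)} (hψ : ψ ≠ 0) : 0 < ∫ x, ψ x * ψ x := by
  obtain ⟨x, hx⟩ : ∃ x, ψ x ≠ 0 := by
    by_contra! h
    exact hψ (TestFunction.ext h)
  exact (ψ.continuous.mul ψ.continuous).integral_pos_of_hasCompactSupport_nonneg_nonzero
    ψ.hasCompactSupport.mul_left (fun y => mul_self_nonneg _) (x := x) (mul_self_ne_zero.mpr hx)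

end SingularElliptic

theorem mainTheorem5 (N : ℕ) (hN : 1 ≤ N)
    (Ω : TopologicalSpace.Opens (EuclideanSpace ℝ (Fin N)))
    (hΩ : SingularElliptic.IsSingularDomain Ω)
    (α b c : ℝ) (hα : α ≠ 2) (hD : b + (((N : ℝ) - 2 + c) / 2) ^ 2 < 0)
    (lam : ℝ) (hlam : 0 < lam) :
    ∃ φ : 𝓓(Ω, ℝ), (∀ x, 0 ≤ φ x) ∧ φ ≠ 0 ∧ SingularElliptic.IsRadialOn Ω φ ∧
      ¬ ∃ u : 𝓓'(Ω, ℝ), SingularElliptic.IsNonnegDistribution u ∧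
        SingularElliptic.IsDistributionalSolution (hΩ.ne_zero hN) α b c lam φ u := by
  obtain ⟨ψ, hψ0, hψ, hrad, hsub⟩ :=
    SingularElliptic.exists_radial_subsolution hN hΩ hα hD hlam
  refine ⟨ψ, hψ0, hψ, hrad, ?_⟩
  rintro ⟨u, hu, hsol⟩
  have h1 := hsol ψ
  have h2 : 0 ≤ u (SingularElliptic.adjointL (hΩ.ne_zero hN) α b c ψ - lam • ψ) :=
    hu _ fun x => by simpa using hsub x
  rw [map_sub, map_smul, smul_eq_mul] at h2
  rw [SingularElliptic.applyL_eq_adjointL] at h1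
  linarith [SingularElliptic.integral_mul_self_pos hψ]
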